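/- Let $G=(V,E)$ be a finite connected simple graph (with at least one vertex), with path distance $d$ and closed balls $B(v,r)=\{w\in V: d(v,w)\le r\}$. For a weight function $\mu:V\to(0,\infty)$ put $\mu(A)=\sum_{w\in A}\mu(w)$ for $A\subseteq V$ and $$C_\mu=\sup_{v\in V,\ r\ge 0}\frac{\mu(B(v,2r))}{\mu(B(v,r))},$$ and let the least doubling constant of $G$ be $C_G=\inf_\mu C_\mu$, the infimum being over all such $\mu$ (for finite $G$ one always has $C_\mu<\infty$). Then $C_G\le 3$ if and only if $G$ is isomorphic to one of the following graphs: - $E_6$ or $E_7$; - the path $L_n$ with $n$ vertices, for some $n\ge 1$; - $D_n$, for some $n\ge 4$; - the cycle $C_n$ with $n$ vertices, for some $n\ge 3$; - $\widehat D_n$, for some $n\ge 5$. Moreover $C_{E_8}>3$, $C_{\widehat E_6}>3$, $C_{\widehat E_7}>3$ and $C_{\widehat E_8}>3$. Here $D_n$ ($n\ge4$ vertices) is the path with $n-1$ vertices together with one further vertex joined to a neighbour of an endpoint of the path; $\widehat D_n$ ($n\ge5$ vertices in total) is the path with consecutive vertices $p_0,p_1,\dots,p_{n-3}$ together with two further vertices,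 one joined to $p_1$ and the other to $p_{n-4}$ (so $\widehat D_5$ is the star with four leaves). Writing $T_{p,q,r}$ for the tree consisting of one central vertex and three paths having $p$, $q$ and $r$ further vertices, each attached by an endpoint to the central vertex, $E_6=T_{1,2,2}$, $E_7=T_{1,2,3}$, $E_8=T_{1,2,4}$, $\widehat E_6=T_{2,2,2}$, $\widehat E_7=T_{1,3,3}$ and $\widehat E_8=T_{1,2,5}$. -/

import Mathlib

open scoped NNReal ENNReal

namespace GraphDoubling

noncomputable section

variable {V : Type*}

/-- The closed ball `B(v, r) = {w : d_G(v, w) ≤ r}` for the path distance of `G`; the radius `r` is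
any nonnegative real number. (For connected `G`, `G.dist` is the length of a shortest path.) -/
def closedBall (G : SimpleGraph V) (v : V) (r : ℝ≥0) : Set V :=
  {w | (G.dist v w : ℝ≥0) ≤ r}

/-- The measure `μ(A) = ∑_{w ∈ A} μ(w)` of a set of vertices, for a weight function `μ`. -/
def mass (μ : V → ℝ≥0) (A : Set V) : ℝ≥0∞ :=
  ∑' w : A, (μ w : ℝ≥0∞)

/-- The doubling constant `C_μ = sup_{v ∈ V, r ≥ 0} μ(B(v, 2r)) / μ(B(v, r))`. -/
def doublingConst (G : SimpleGraph V) (μ : V → ℝ≥0) : ℝ≥0∞ :=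
  ⨆ (v : V) (r : ℝ≥0), mass μ (closedBall G v (2 * r)) / mass μ (closedBall G v r)

/-- A doubling measure on `G`: a weight function with values in `(0, ∞)` whose doubling constant is
finite. -/
def IsDoublingMeasure (G : SimpleGraph V) (μ : V → ℝ≥0) : Prop :=
  (∀ v, 0 < μ v) ∧ doublingConst G μ < ∞

/-- The least doubling constant `C_G`, the infimum of `C_μ` over all doubling measures on `G`. -/
def leastDoublingConst (G : SimpleGraph V) : ℝ≥0∞ :=
  ⨅ (μ : V → ℝ≥0) (_ : IsDoublingMeasure G μ), doublingConst G μ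

end

/-- The Dynkin graph `D_n` on `n ≥ 4` vertices: the path `0 - 1 - ... - (n-2)` together with the
vertex `n-1` joined to `n-3`. -/
def dynkinD (n : ℕ) : SimpleGraph (Fin n) :=
  SimpleGraph.fromRel fun i j =>
    (i.val + 1 = j.val ∧ j.val + 1 < n) ∨ (i.val + 3 = n ∧ j.val + 1 = n)

/-- The extended Dynkin graph of type `D`, on `n ≥ 5` vertices (`n` counts all vertices):
the path `0 - 1 - ... - (n-3)` together with the vertex `n-2` joined to `1`
and the vertex `n-1` joined to `n-4`. -/
def extDynkinD (n : ℕ) : SimpleGraph (Fin n) :=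
  SimpleGraph.fromRel fun i j =>
    (i.val + 1 = j.val ∧ j.val + 2 < n) ∨ (i.val = 1 ∧ j.val + 2 = n) ∨
      (i.val + 4 = n ∧ j.val + 1 = n)

/-- The Dynkin graph `E_6`: the path `0 - 1 - 2 - 3 - 4`, and `5` joined to `2`. -/
def dynkinE6 : SimpleGraph (Fin 6) :=
  SimpleGraph.fromRel fun i j =>
    (i.val + 1 = j.val ∧ j.val < 5) ∨ (i.val = 2 ∧ j.val = 5)

/-- The Dynkin graph `E_7`: the path `0 - 1 - 2 - 3 - 4 - 5`, and `6` joined to `2`. -/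
def dynkinE7 : SimpleGraph (Fin 7) :=
  SimpleGraph.fromRel fun i j =>
    (i.val + 1 = j.val ∧ j.val < 6) ∨ (i.val = 2 ∧ j.val = 6)

/-- The Dynkin graph `E_8`: the path `0 - 1 - 2 - 3 - 4 - 5 - 6`, and `7` joined to `2`. -/
def dynkinE8 : SimpleGraph (Fin 8) :=
  SimpleGraph.fromRel fun i j =>
    (i.val + 1 = j.val ∧ j.val < 7) ∨ (i.val = 2 ∧ j.val = 7)

/-- The extended Dynkin graph of type `E_6`: the path `0 - 1 - 2 - 3 - 4`, with the path
`2 - 5 - 6` attached at its midpoint. -/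
def extDynkinE6 : SimpleGraph (Fin 7) :=
  SimpleGraph.fromRel fun i j =>
    (i.val + 1 = j.val ∧ j.val < 5) ∨ (i.val = 2 ∧ j.val = 5) ∨ (i.val = 5 ∧ j.val = 6)

/-- The extended Dynkin graph of type `E_7`: the path `0 - 1 - 2 - 3 - 4 - 5 - 6`, and `7` joined
to the midpoint `3`. -/
def extDynkinE7 : SimpleGraph (Fin 8) :=
  SimpleGraph.fromRel fun i j =>
    (i.val + 1 = j.val ∧ j.val < 7) ∨ (i.val = 3 ∧ j.val = 7)

/-- The extended Dynkin graph of type `E_8`: the path `0 - 1 - 2 - 3 - 4 - 5 - 6 - 7`, and `8`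
joined to `2`. -/
def extDynkinE8 : SimpleGraph (Fin 9) :=
  SimpleGraph.fromRel fun i j =>
    (i.val + 1 = j.val ∧ j.val < 8) ∨ (i.val = 2 ∧ j.val = 8)

end GraphDoubling

/-! Only integer radii matter: `C_μ ≤ 3` says that `μ(B(v, 2k+1)) ≤ 3 μ(B(v, k))` for all `v` and
all natural `k`. By compactness the infimum is attained when it is at most 3, so `C_G ≤ 3` means
that such a positive weight exists.

The case `k = 0` reads `A μ ≤ 2 μ` for the adjacency operator `A`. This is the hypothesis of Smith's
theorem: if `G` contains a copy of a graph `H` with a positive weight `δ` such that `2 δ ≤ A δ`,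
then pairing `μ` with `δ` forces equality everywhere, hence `G ≅ H` (`nonempty_iso_of_subharmonic`).
Cycles and extended Dynkin graphs carry such a `δ`, so none of them sits properly inside `G`. A
graph with a cycle is thus a cycle. In a tree, a longest path and the vertices hanging off it leave
only Dynkin and extended Dynkin trees.

The case `k = 1` at ends of arms removes `E_8` and the three extended graphs of type `E`. Every
remaining graph has an explicit weight: the constant one on cycles, total weight two over each
vertex of an underlying path for the families `L`, `D` and extended `D`, and numerical weights for
`E_6` and `E_7`. -/

namespace GraphDoubling

/-! ### Reduction to integer radii and attainment of the infimum -/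

section Tripling

variable {V : Type*}

/-- A positive weight for which every ball of radius `2 * k + 1` has at most three times the weight
of the concentric ball of radius `k`. -/
def IsTripling [Fintype V] (G : SimpleGraph V) (μ : V → ℝ) : Prop :=
  (∀ v, 0 < μ v) ∧
    ∀ v k, ∑ w with G.dist v w ≤ 2 * k + 1, μ w ≤ 3 * ∑ w with G.dist v w ≤ k, μ w

lemma mass_closedBall [Fintype V] (G : SimpleGraph V) (μ : V → ℝ≥0) (v : V) (r : ℝ≥0) :
    mass μ (closedBall G v r) = ((∑ w with G.dist v w ≤ ⌊r⌋₊, μ w : ℝ≥0) : ℝ≥0∞) := by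
  classical
  have h : closedBall G v r = ↑(Finset.univ.filter fun w => G.dist v w ≤ ⌊r⌋₊) := by
    ext w
    simp [closedBall, Nat.le_floor_iff]
  rw [mass, h, ENNReal.ofNNReal_finsetSum]
  exact Finset.tsum_subtype _ fun w => (μ w : ℝ≥0∞)

/-- Balls depend only on the integer part of the radius, and `⌊2r⌋ ≤ 2⌊r⌋ + 1`, so the worst radius
with `⌊r⌋ = k` compares `2k + 1` with `k`. -/
lemma doublingConst_le_iff [Fintype V] (G : SimpleGraph V) {μ : V → ℝ≥0} (hμ : ∀ v, 0 < μ v)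
    (c : ℝ≥0) :
    doublingConst G μ ≤ c ↔
      ∀ v k, ∑ w with G.dist v w ≤ 2 * k + 1, μ w ≤ c * ∑ w with G.dist v w ≤ k, μ w := by
  have hpos : ∀ v k, 0 < ∑ w with G.dist v w ≤ k, μ w := fun v k =>
    Finset.sum_pos (fun w _ => hμ w) ⟨v, by simp⟩
  have key : ∀ v (r : ℝ≥0),
      mass μ (closedBall G v (2 * r)) / mass μ (closedBall G v r) ≤ c ↔
        ∑ w with G.dist v w ≤ ⌊2 * r⌋₊, μ w ≤ c * ∑ w with G.dist v w ≤ ⌊r⌋₊, μ w := by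
    intro v r
    rw [mass_closedBall, mass_closedBall, ENNReal.div_le_iff (by simpa using (hpos v _).ne')
      (by simp), ← ENNReal.coe_mul, ENNReal.coe_le_coe]
  simp only [doublingConst, iSup_le_iff, key]
  constructor
  · intro h v k
    -- The radius `k + 1/2` realises the extreme case of the floor inequality.
    have h1 : ⌊(k : ℝ≥0) + 1 / 2⌋₊ = k := by
      rw [Nat.floor_eq_iff (by positivity)]
      constructor
      · simp
      · gcongr
        exact_mod_cast NNReal.half_lt_self one_ne_zero
    have h2 : ⌊2 * ((k : ℝ≥0) + 1 / 2)⌋₊ = 2 * k + 1 := by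
      have : 2 * ((k : ℝ≥0) + 1 / 2) = ((2 * k + 1 : ℕ) : ℝ≥0) := by
        push_cast
        field_simp
      rw [this, Nat.floor_natCast]
    have := h v ((k : ℝ≥0) + 1 / 2)
    rwa [h1, h2] at this
  · intro h v r
    refine le_trans (Finset.sum_le_sum_of_subset ?_) (h v ⌊r⌋₊)
    have h1 : ⌊2 * r⌋₊ ≤ 2 * ⌊r⌋₊ + 1 := by
      rw [← Nat.lt_succ_iff, Nat.floor_lt (by positivity)]
      have := Nat.lt_floor_add_one r
      push_cast
      calc 2 * r < 2 * (⌊r⌋₊ + 1) := by gcongr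
        _ = 2 * ⌊r⌋₊ + 1 + 1 := by ring
    intro w
    simp only [Finset.mem_filter, Finset.mem_univ, true_and]
    omega

lemma leastDoublingConst_le_of_isTripling [Fintype V] {G : SimpleGraph V} {μ : V → ℝ}
    (h : IsTripling G μ) : leastDoublingConst G ≤ 3 := by
  have hpos : ∀ v, 0 < (μ v).toNNReal := fun v => Real.toNNReal_pos.2 (h.1 v)
  have hle : doublingConst G (fun v => (μ v).toNNReal) ≤ (3 : ℝ≥0) := by
    rw [doublingConst_le_iff G hpos]
    intro v k
    have h1 := h.2 v k
    rw [← NNReal.coe_le_coe]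
    push_cast
    simpa only [Real.coe_toNNReal _ (h.1 _).le] using h1
  refine (iInf₂_le (fun v => (μ v).toNNReal) ⟨hpos, hle.trans_lt ENNReal.coe_lt_top⟩).trans ?_
  simpa using hle

/-- The case `k = 0`, that is, `A μ ≤ 2 μ`. Positivity of `μ` is not assumed, because the
compactness argument applies this to a limit weight that might vanish somewhere. -/
lemma isTripling_neighbor_sum [Fintype V] {G : SimpleGraph V} {μ : V → ℝ} (hG : G.Connected)
    (h : ∀ v k, ∑ w with G.dist v w ≤ 2 * k + 1, μ w ≤ 3 * ∑ w with G.dist v w ≤ k, μ w)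
    (v : V) [DecidableRel G.Adj] : ∑ w with G.Adj v w, μ w ≤ 2 * μ v := by
  classical
  have h0 : (Finset.univ.filter fun w => G.dist v w ≤ 0) = {v} := by
    ext w
    simp [hG.dist_eq_zero_iff, eq_comm]
  have h1 : (Finset.univ.filter fun w => G.dist v w ≤ 2 * 0 + 1) =
      insert v (Finset.univ.filter fun w => G.Adj v w) := by
    ext w
    simp [Nat.le_one_iff_eq_zero_or_eq_one, hG.dist_eq_zero_iff, SimpleGraph.dist_eq_one_iff_adj,
      eq_comm (a := w)]
  have := h v 0
  rw [h0, h1, Finset.sum_insert (by simp), Finset.sum_singleton] at this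
  linarith

/-- The conditions are homogeneous, so weights may be normalised to the compact simplex. The weights
admissible for the constants `3 + 1/(n+1)` form nested nonempty compact sets, and a common point is
admissible for 3. Such a limit is positive: a zero would spread along edges by `A μ ≤ 2 μ`,
contradicting total mass one. -/
lemma exists_isTripling [Fintype V] {G : SimpleGraph V} (hG : G.Connected)
    (h : leastDoublingConst G ≤ 3) : ∃ μ, IsTripling G μ := by
  classical
  let K : ℕ → Set (V → ℝ) := fun n => stdSimplex ℝ V ∩ ⋂ (v) (k),
    {μ | ∑ w with G.dist v w ≤ 2 * k + 1, μ w ≤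
      (3 + 1 / ((n : ℝ) + 1)) * ∑ w with G.dist v w ≤ k, μ w}
  have hclosed : ∀ n, IsClosed (K n) := fun n =>
    (isClosed_stdSimplex ℝ V).inter <| isClosed_iInter fun v => isClosed_iInter fun k =>
      isClosed_le (by fun_prop) (by fun_prop)
  have hanti : ∀ n, K (n + 1) ⊆ K n := by
    rintro n μ ⟨h1, h2⟩
    refine ⟨h1, ?_⟩
    simp only [Set.mem_iInter, Set.mem_ofPred_eq] at h2 ⊢
    intro v k
    refine (h2 v k).trans ?_
    have : 0 ≤ ∑ w with G.dist v w ≤ k, μ w := Finset.sum_nonneg fun w _ => h1.1 w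
    gcongr
    simp
  have hne : ∀ n, (K n).Nonempty := by
    intro n
    have hlt : leastDoublingConst G < ((3 + 1 / ((n : ℝ≥0) + 1) : ℝ≥0) : ℝ≥0∞) := by
      refine h.trans_lt ?_
      have : ((3 : ℝ≥0) : ℝ≥0∞) < ((3 + 1 / ((n : ℝ≥0) + 1) : ℝ≥0) : ℝ≥0∞) := by
        rw [ENNReal.coe_lt_coe]
        exact lt_add_of_pos_right _ (by positivity)
      simpa using this
    simp only [leastDoublingConst, iInf_lt_iff] at hlt
    obtain ⟨μ, hμ, hlt⟩ := hlt
    have hle := (doublingConst_le_iff G hμ.1 _).1 hlt.le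
    have hS : 0 < ∑ w, (μ w : ℝ) :=
      Finset.sum_pos (fun w _ => hμ.1 w) (Finset.univ_nonempty_iff.2 hG.nonempty)
    refine ⟨fun w => (μ w : ℝ) / ∑ w, (μ w : ℝ), ⟨fun w => by positivity, ?_⟩, ?_⟩
    · rw [← Finset.sum_div, div_self hS.ne']
    · simp only [Set.mem_iInter, Set.mem_ofPred_eq]
      intro v k
      rw [← Finset.sum_div, ← Finset.sum_div, ← mul_div_assoc]
      have := hle v k
      rw [← NNReal.coe_le_coe] at this
      push_cast at this
      gcongr
  obtain ⟨μ, hμ⟩ := IsCompact.nonempty_iInter_of_sequence_nonempty_isCompact_isClosed K hanti hne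
    ((isCompact_stdSimplex ℝ V).inter_right (isClosed_iInter fun v => isClosed_iInter fun k =>
      isClosed_le (by fun_prop) (by fun_prop))) hclosed
  rw [Set.mem_iInter] at hμ
  have h3 : ∀ v k, ∑ w with G.dist v w ≤ 2 * k + 1, μ w ≤ 3 * ∑ w with G.dist v w ≤ k, μ w := by
    intro v k
    have hlim : Filter.Tendsto (fun n : ℕ => (3 + 1 / ((n : ℝ) + 1)) *
        ∑ w with G.dist v w ≤ k, μ w) Filter.atTop
        (nhds ((3 + 0) * ∑ w with G.dist v w ≤ k, μ w)) :=
      (tendsto_one_div_add_atTop_nhds_zero_nat.const_add 3).mul_const _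
    rw [add_zero] at hlim
    refine ge_of_tendsto' hlim fun n => ?_
    have := (hμ n).2
    simp only [Set.mem_iInter, Set.mem_ofPred_eq] at this
    exact this v k
  have hnn : ∀ v, 0 ≤ μ v := (hμ 0).1.1
  refine ⟨μ, fun v => (hnn v).lt_of_ne' fun hv => ?_, h3⟩
  have hstep : ∀ u w, G.Adj u w → μ u = 0 → μ w = 0 := by
    intro u w huw hu
    have h1 := isTripling_neighbor_sum hG h3 u
    have h2 : μ w ≤ ∑ w with G.Adj u w, μ w :=
      Finset.single_le_sum (fun i _ => hnn i) (by simpa using huw)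
    have := hnn w
    linarith
  have hall : ∀ w, μ w = 0 := by
    intro w
    obtain ⟨p⟩ := hG.preconnected v w
    induction p with
    | nil => exact hv
    | cons hadj _ ih => exact ih (hstep _ _ hadj hv)
  have := (hμ 0).1.2
  simp [hall] at this

lemma leastDoublingConst_le_iff [Fintype V] {G : SimpleGraph V} (hG : G.Connected) :
    leastDoublingConst G ≤ 3 ↔ ∃ μ, IsTripling G μ :=
  ⟨exists_isTripling hG, fun ⟨_, h⟩ => leastDoublingConst_le_of_isTripling h⟩

end Tripling

/-! ### Isomorphism invariance and certification of distances -/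

lemma dist_map_iso {V W : Type*} {G : SimpleGraph V} {H : SimpleGraph W} (e : G ≃g H)
    (hG : G.Connected) (u v : V) : H.dist (e u) (e v) = G.dist u v := by
  have hH : H.Connected := e.connected_iff.1 hG
  apply le_antisymm
  · obtain ⟨p, hp⟩ := hG.exists_walk_length_eq_dist u v
    rw [← hp, ← p.length_map e.toHom]
    exact SimpleGraph.dist_le _
  · obtain ⟨p, hp⟩ := hH.exists_walk_length_eq_dist (e u) (e v)
    rw [← hp, ← p.length_map e.symm.toHom]
    have := SimpleGraph.dist_le (p.map e.symm.toHom)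
    simpa using this

lemma IsTripling.of_iso {V W : Type*} [Fintype V] [Fintype W] {G : SimpleGraph V}
    {H : SimpleGraph W} (e : G ≃g H) (hG : G.Connected) {μ : W → ℝ} (h : IsTripling H μ) :
    IsTripling G (μ ∘ e) := by
  refine ⟨fun v => h.1 _, fun v k => ?_⟩
  have key : ∀ j, ∑ w with G.dist v w ≤ j, (μ ∘ e) w = ∑ w with H.dist (e v) w ≤ j, μ w := by
    intro j
    refine Finset.sum_equiv e.toEquiv (fun w => ?_) (fun w _ => rfl)
    simp [dist_map_iso e hG]
  rw [key, key]
  exact h.2 _ _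

/-- Descending neighbours build walks of length `d`; since `d` grows by at most one along an edge,
no walk is shorter. -/
lemma dist_eq_of_table {V : Type*} [Nonempty V] {G : SimpleGraph V} (d : V → V → ℕ)
    (h0 : ∀ v, d v v = 0) (hadj : ∀ u v w, G.Adj v w → d u w ≤ d u v + 1)
    (hdesc : ∀ u w, u ≠ w → ∃ v, G.Adj v w ∧ d u v + 1 = d u w) :
    G.Connected ∧ ∀ u v, G.dist u v = d u v := by
  have hup : ∀ k u v, d u v = k → ∃ p : G.Walk u v, p.length = k := by
    intro k
    induction k with
    | zero =>
      intro u v h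
      by_cases huv : u = v
      · subst huv
        exact ⟨.nil, rfl⟩
      · obtain ⟨w, _, hw⟩ := hdesc u v huv
        omega
    | succ k ih =>
      intro u v h
      have huv : u ≠ v := by
        rintro rfl
        rw [h0] at h
        omega
      obtain ⟨w, hwv, hw⟩ := hdesc u v huv
      obtain ⟨p, hp⟩ := ih u w (by omega)
      exact ⟨p.concat hwv, by simp [hp]⟩
  have hlow : ∀ u {v w} (p : G.Walk v w), d u w ≤ d u v + p.length := by
    intro u v w p
    induction p with
    | nil => simp
    | cons h p ih =>
      have := hadj u _ _ h
      rw [SimpleGraph.Walk.length_cons]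
      omega
  have hconn : G.Connected := ⟨fun u v => (hup _ u v rfl).choose.reachable⟩
  refine ⟨hconn, fun u v => le_antisymm ?_ ?_⟩
  · obtain ⟨p, hp⟩ := hup _ u v rfl
    exact hp ▸ SimpleGraph.dist_le p
  · obtain ⟨p, hp⟩ := hconn.exists_walk_length_eq_dist u v
    have := hlow u p
    rwa [h0, zero_add, hp] at this

/-! ### The exceptional graphs of type `E` -/

section Comb

/-- The distance in the tree formed by the path `0, …, p` and a path `p + 1, p + 2, …` attached to
the vertex `c` of the former. -/
def combDist (p c i j : ℕ) : ℕ :=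
  let x : ℕ → ℕ := fun i => if i ≤ p then i else c
  -- Truncated subtraction makes `i - p` zero on the main path and the depth on the attached one.
  Nat.dist (x i) (x j) + Nat.dist (i - p) (j - p)

lemma dist_dynkinE6 : dynkinE6.Connected ∧ ∀ u v, dynkinE6.dist u v = combDist 4 2 u v :=
  dist_eq_of_table _ (by decide +kernel)
    (by simp only [dynkinE6, SimpleGraph.fromRel_adj]; decide +kernel)
    (by simp only [dynkinE6, SimpleGraph.fromRel_adj]; decide +kernel)

lemma dist_dynkinE7 : dynkinE7.Connected ∧ ∀ u v, dynkinE7.dist u v = combDist 5 2 u v :=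
  dist_eq_of_table _ (by decide +kernel)
    (by simp only [dynkinE7, SimpleGraph.fromRel_adj]; decide +kernel)
    (by simp only [dynkinE7, SimpleGraph.fromRel_adj]; decide +kernel)

lemma dist_dynkinE8 : dynkinE8.Connected ∧ ∀ u v, dynkinE8.dist u v = combDist 6 2 u v :=
  dist_eq_of_table _ (by decide +kernel)
    (by simp only [dynkinE8, SimpleGraph.fromRel_adj]; decide +kernel)
    (by simp only [dynkinE8, SimpleGraph.fromRel_adj]; decide +kernel)

lemma dist_extDynkinE6 : extDynkinE6.Connected ∧ ∀ u v, extDynkinE6.dist u v = combDist 4 2 u v :=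
  dist_eq_of_table _ (by decide +kernel)
    (by simp only [extDynkinE6, SimpleGraph.fromRel_adj]; decide +kernel)
    (by simp only [extDynkinE6, SimpleGraph.fromRel_adj]; decide +kernel)

lemma dist_extDynkinE7 : extDynkinE7.Connected ∧ ∀ u v, extDynkinE7.dist u v = combDist 6 3 u v :=
  dist_eq_of_table _ (by decide +kernel)
    (by simp only [extDynkinE7, SimpleGraph.fromRel_adj]; decide +kernel)
    (by simp only [extDynkinE7, SimpleGraph.fromRel_adj]; decide +kernel)

lemma dist_extDynkinE8 : extDynkinE8.Connected ∧ ∀ u v, extDynkinE8.dist u v = combDist 7 2 u v :=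
  dist_eq_of_table _ (by decide +kernel)
    (by simp only [extDynkinE8, SimpleGraph.fromRel_adj]; decide +kernel)
    (by simp only [extDynkinE8, SimpleGraph.fromRel_adj]; decide +kernel)

/-- Once `k` reaches a bound `D` for the diameter, both balls are the whole graph, which leaves a
finite check. -/
lemma isTripling_of_nat {V : Type*} [Fintype V] {G : SimpleGraph V} {d : V → V → ℕ}
    (hd : ∀ u v, G.dist u v = d u v) (D : ℕ) (hD : ∀ u v, d u v ≤ D) (m : V → ℕ)
    (hpos : ∀ v, 0 < m v)
    (h : ∀ v, ∀ k < D, ∑ w with d v w ≤ 2 * k + 1, m w ≤ 3 * ∑ w with d v w ≤ k, m w) :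
    IsTripling G fun v => (m v : ℝ) := by
  refine ⟨fun v => Nat.cast_pos.2 (hpos v), fun v k => ?_⟩
  simp only [hd]
  rcases lt_or_ge k D with hk | hk
  · exact_mod_cast h v k hk
  · have : ∀ j, D ≤ j → (Finset.univ.filter fun w => d v w ≤ j) = Finset.univ := fun j hj =>
      Finset.filter_true_of_mem fun w _ => (hD v w).trans hj
    rw [this _ hk, this _ (by omega)]
    have : (0 : ℝ) ≤ ∑ w, (m w : ℝ) := by positivity
    linarith

lemma exists_isTripling_dynkinE6 : ∃ μ, IsTripling dynkinE6 μ :=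
  ⟨_, isTripling_of_nat dist_dynkinE6.2 4 (by decide +kernel)
    -- This weight satisfies `A μ = 2 μ` except at the path ends 0 and 4, where there is slack.
    (fun v => [2, 3, 4, 3, 2, 2].getD v 0)
    (by decide +kernel) (by decide +kernel)⟩

lemma exists_isTripling_dynkinE7 : ∃ μ, IsTripling dynkinE7 μ :=
  ⟨_, isTripling_of_nat dist_dynkinE7.2 5 (by decide +kernel)
    -- Here `A μ = 2 μ` except at 0 and 5; the ball of radius 3 about 0 has exactly three times the
    -- weight of the ball of radius 1.
    (fun v => [6, 10, 14, 11, 8, 5, 7].getD v 0)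
    (by decide +kernel) (by decide +kernel)⟩

lemma sum_filter_eq_of_dist {n : ℕ} {G : SimpleGraph (Fin n)} {d : ℕ → ℕ → ℕ}
    (hd : ∀ u v, G.dist u v = d u v) (μ : Fin n → ℝ) (v : Fin n) (k : ℕ) :
    ∑ w with G.dist v w ≤ k, μ w = ∑ w : Fin n, if d v w ≤ k then μ w else 0 := by
  simp only [hd, Finset.sum_filter]

/-- The spectral radius of `E_8` is below 2, so `k = 0` alone cannot exclude it. Taking `k = 1` at
the path ends 0 and 6, and `k = 0` elsewhere, gives an inconsistent linear system. -/
lemma not_isTripling_dynkinE8 (μ : Fin 8 → ℝ) : ¬ IsTripling dynkinE8 μ := by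
  rintro ⟨hpos, h⟩
  simp only [sum_filter_eq_of_dist dist_dynkinE8.2] at h
  have hp := hpos 0
  have h0 := h 0 1
  have h1 := h 1 0
  have h2 := h 2 0
  have h3 := h 3 0
  have h4 := h 4 0
  have h5 := h 5 0
  have h6 := h 6 1
  have h7 := h 7 0
  simp only [Fin.sum_univ_eight, combDist, Nat.dist] at h0 h1 h2 h3 h4 h5 h6 h7
  norm_num at h0 h1 h2 h3 h4 h5 h6 h7
  linarith

/-- The weight `1, 2, 3, 2, 1, 2, 1` satisfies all the inequalities with `k = 0` as equalities, but
about vertex 0 its balls of radii 3 and 1 weigh 10 and 3. So `k = 1` is again needed at some ends;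
the other two extended graphs behave alike. -/
lemma not_isTripling_extDynkinE6 (μ : Fin 7 → ℝ) : ¬ IsTripling extDynkinE6 μ := by
  rintro ⟨hpos, h⟩
  simp only [sum_filter_eq_of_dist dist_extDynkinE6.2] at h
  have hp := hpos 0
  have h0 := h 0 1
  have h1 := h 1 0
  have h2 := h 2 0
  have h3 := h 3 0
  have h4 := h 4 1
  have h5 := h 5 0
  have h6 := h 6 0
  simp only [Fin.sum_univ_seven, combDist, Nat.dist] at h0 h1 h2 h3 h4 h5 h6
  norm_num at h0 h1 h2 h3 h4 h5 h6
  linarith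

lemma not_isTripling_extDynkinE7 (μ : Fin 8 → ℝ) : ¬ IsTripling extDynkinE7 μ := by
  rintro ⟨hpos, h⟩
  simp only [sum_filter_eq_of_dist dist_extDynkinE7.2] at h
  have hp := hpos 0
  have h0 := h 0 1
  have h1 := h 1 0
  have h2 := h 2 0
  have h3 := h 3 0
  have h4 := h 4 0
  have h5 := h 5 0
  have h6 := h 6 1
  have h7 := h 7 0
  simp only [Fin.sum_univ_eight, combDist, Nat.dist] at h0 h1 h2 h3 h4 h5 h6 h7
  norm_num at h0 h1 h2 h3 h4 h5 h6 h7
  linarith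

lemma sum_univ_fin_nine (f : Fin 9 → ℝ) :
    ∑ i, f i = f 0 + f 1 + f 2 + f 3 + f 4 + f 5 + f 6 + f 7 + f 8 := by
  rw [Fin.sum_univ_castSucc, Fin.sum_univ_eight]
  rfl

lemma not_isTripling_extDynkinE8 (μ : Fin 9 → ℝ) : ¬ IsTripling extDynkinE8 μ := by
  rintro ⟨hpos, h⟩
  simp only [sum_filter_eq_of_dist dist_extDynkinE8.2] at h
  have hp := hpos 0
  have h0 := h 0 1
  have h1 := h 1 0
  have h2 := h 2 0
  have h3 := h 3 0
  have h4 := h 4 0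
  have h5 := h 5 0
  have h6 := h 6 0
  have h7 := h 7 1
  have h8 := h 8 0
  simp only [sum_univ_fin_nine, combDist, Nat.dist] at h0 h1 h2 h3 h4 h5 h6 h7 h8
  norm_num at h0 h1 h2 h3 h4 h5 h6 h7 h8
  linarith

end Comb

/-! ### Weights on paths with possibly doubled ends -/

section Fibred

variable {V : Type*}

/-- `G` is the pullback of the path `0, …, m` along `π`, the fibres of `π` are single vertices of
weight two, or, at the ends of the path, possibly pairs of vertices of weight one. -/
structure IsFibredPath (G : SimpleGraph V) (π : V → ℕ) (m : ℕ) (μ : V → ℝ) : Prop where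
  adj_iff : ∀ u v, G.Adj u v ↔ π u + 1 = π v ∨ π v + 1 = π u
  le : ∀ v, π v ≤ m
  fibre : ∀ j ≤ m, (∃ v, μ v = 2 ∧ ∀ w, π w = j ↔ w = v) ∨
    (∃ u v, u ≠ v ∧ μ u = 1 ∧ μ v = 1 ∧ 1 ≤ m ∧ (j = 0 ∨ j = m) ∧ ∀ w, π w = j ↔ w = u ∨ w = v)

variable {G : SimpleGraph V} {π : V → ℕ} {m : ℕ} {μ : V → ℝ}

lemma IsFibredPath.exists_eq (h : IsFibredPath G π m μ) {j : ℕ} (hj : j ≤ m) : ∃ v, π v = j := by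
  rcases h.fibre j hj with ⟨v, _, hv⟩ | ⟨u, v, _, _, _, _, _, hv⟩
  · exact ⟨v, (hv v).2 rfl⟩
  · exact ⟨u, (hv u).2 (.inl rfl)⟩

lemma IsFibredPath.sum_fibre [Fintype V] (h : IsFibredPath G π m μ) {j : ℕ} (hj : j ≤ m) :
    ∑ w with π w = j, μ w = 2 := by
  classical
  rcases h.fibre j hj with ⟨v, h2, hv⟩ | ⟨u, v, huv, h1, h1', _, _, hv⟩
  · have : (Finset.univ.filter fun w => π w = j) = {v} := by ext w; simp [hv]
    rw [this, Finset.sum_singleton, h2]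
  · have : (Finset.univ.filter fun w => π w = j) = {u, v} := by ext w; simp [hv]
    rw [this, Finset.sum_pair huv, h1, h1']
    norm_num

lemma IsFibredPath.pos (h : IsFibredPath G π m μ) (v : V) : 0 < μ v := by
  rcases h.fibre (π v) (h.le v) with ⟨w, h2, hw⟩ | ⟨u, w, _, h1, h1', _, _, hw⟩
  · rw [(hw v).1 rfl, h2]
    norm_num
  · rcases (hw v).1 rfl with rfl | rfl <;> simp [*]

/-- The projection `π` preserves distances, except that twins in one fibre are at distance 2 through
a neighbouring fibre. -/
lemma IsFibredPath.dist_eq [DecidableEq V] [Nonempty V] (h : IsFibredPath G π m μ) :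
    G.Connected ∧ ∀ u v, G.dist u v =
      if u = v then 0 else if π u = π v then 2 else Nat.dist (π u) (π v) := by
  refine dist_eq_of_table _ (by simp) ?_ ?_
  · intro u v w hvw
    have hne := hvw.ne
    rw [h.adj_iff] at hvw
    by_cases h1 : u = v
    · subst h1
      rw [if_neg hne, if_neg (by omega), if_pos rfl, Nat.dist]
      omega
    · rw [if_neg h1]
      simp only [Nat.dist]
      split_ifs <;> omega
  · intro u w huw
    rw [if_neg huw]
    have hu := h.le u
    have hw := h.le w
    by_cases hπ : π u = π w
    · rw [if_pos hπ]
      have hm : 1 ≤ m := by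
        rcases h.fibre (π w) hw with ⟨v, _, hv⟩ | ⟨_, _, _, _, _, hm, _⟩
        · exact absurd (((hv u).1 hπ).trans ((hv w).1 rfl).symm) huw
        · exact hm
      obtain ⟨v, hv⟩ : ∃ v, π v + 1 = π w ∨ π w + 1 = π v := by
        rcases Nat.eq_zero_or_pos (π w) with h0 | h0
        · obtain ⟨v, hv⟩ := h.exists_eq hm
          exact ⟨v, by omega⟩
        · obtain ⟨v, hv⟩ := h.exists_eq (j := π w - 1) (by omega)
          exact ⟨v, by omega⟩
      refine ⟨v, (h.adj_iff _ _).2 hv, ?_⟩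
      rw [if_neg (by rintro rfl; omega), if_neg (by omega), Nat.dist]
      omega
    · rw [if_neg hπ]
      rcases eq_or_ne (Nat.dist (π u) (π w)) 1 with h1 | h1
      · refine ⟨u, (h.adj_iff _ _).2 ?_, ?_⟩
        · rw [Nat.dist] at h1
          omega
        · rw [if_pos rfl, h1]
      · rw [Nat.dist] at h1 ⊢
        obtain ⟨v, hv⟩ := h.exists_eq (j := if π u < π w then π w - 1 else π w + 1)
          (by split_ifs <;> omega)
        split_ifs at hv with hlt
        · refine ⟨v, (h.adj_iff _ _).2 (by omega), ?_⟩
          rw [if_neg (by rintro rfl; omega), if_neg (by omega), Nat.dist]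
          omega
        · refine ⟨v, (h.adj_iff _ _).2 (by omega), ?_⟩
          rw [if_neg (by rintro rfl; omega), if_neg (by omega), Nat.dist]
          omega

lemma IsFibredPath.sum_interval [Fintype V] (h : IsFibredPath G π m μ) (a b : ℕ) :
    ∑ w with a ≤ π w ∧ π w ≤ b, μ w = ((2 * (min m b + 1 - a) : ℕ) : ℝ) := by
  classical
  have hmaps : ∀ w ∈ Finset.univ.filter fun w => a ≤ π w ∧ π w ≤ b,
      π w ∈ Finset.Icc a (min m b) := by
    intro w
    have := h.le w
    simp
    omega
  rw [← Finset.sum_fiberwise_of_maps_to hmaps]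
  have : ∀ j ∈ Finset.Icc a (min m b),
      ∑ w ∈ (Finset.univ.filter fun w => a ≤ π w ∧ π w ≤ b) with π w = j, μ w = 2 := by
    intro j hj
    rw [Finset.mem_Icc] at hj
    rw [Finset.filter_filter, ← h.sum_fibre (j := j) (by omega)]
    congr 1
    ext w
    simp
    omega
  rw [Finset.sum_congr rfl this, Finset.sum_const, Nat.card_Icc]
  push_cast [nsmul_eq_mul]
  ring

/-- Each fibre weighs 2, so balls are compared with intervals of the path, where tripling is
arithmetic. A ball is smaller than the preimage of its interval only if it misses the twin of its
centre, which needs `k ≤ 1`. -/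
theorem IsFibredPath.isTripling [Fintype V] [Nonempty V] (h : IsFibredPath G π m μ) :
    IsTripling G μ := by
  classical
  have hd := h.dist_eq.2
  refine ⟨h.pos, fun v k => ?_⟩
  have hle : ∀ k, ∑ w with G.dist v w ≤ k, μ w ≤
      ((2 * (min m (π v + k) + 1 - (π v - k)) : ℕ) : ℝ) := by
    intro k
    rw [← h.sum_interval]
    refine Finset.sum_le_sum_of_subset_of_nonneg ?_ fun w _ _ => (h.pos w).le
    intro w
    simp only [Finset.mem_filter, Finset.mem_univ, true_and, hd, Nat.dist]
    split_ifs with h1 h2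
    · subst h1; omega
    · omega
    · omega
  have hv := h.le v
  have hge : ((∀ w, π w = π v → w = v) ∨ 2 ≤ k) →
      ((2 * (min m (π v + k) + 1 - (π v - k)) : ℕ) : ℝ) ≤ ∑ w with G.dist v w ≤ k, μ w := by
    intro hk
    rw [← h.sum_interval]
    refine Finset.sum_le_sum_of_subset_of_nonneg ?_ fun w _ _ => (h.pos w).le
    intro w
    simp only [Finset.mem_filter, Finset.mem_univ, true_and, hd, Nat.dist]
    split_ifs with h1 h2
    · omega
    · rcases hk with hk | hk
      · exact absurd (hk w h2.symm).symm h1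
      · omega
    · omega
  have hmain : 2 * (min m (π v + (2 * k + 1)) + 1 - (π v - (2 * k + 1))) ≤
      3 * (2 * (min m (π v + k) + 1 - (π v - k))) := by omega
  by_cases hk : (∀ w, π w = π v → w = v) ∨ 2 ≤ k
  · refine (hle _).trans (le_trans ?_ (mul_le_mul_of_nonneg_left (hge hk) (by norm_num)))
    exact_mod_cast hmain
  · rw [not_or, not_le] at hk
    rcases h.fibre (π v) hv with ⟨u, _, hu⟩ | ⟨u, u', huu', h1, h1', hm, hend, hu⟩
    · exact absurd (fun w hw => ((hu w).1 hw).trans ((hu v).1 rfl).symm) hk.1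
    · have hμv : μ v = 1 := by
        rcases (hu v).1 rfl with rfl | rfl <;> assumption
      -- The fibre next to the end containing `v`. The balls of radii 0 and 1 about `v` weigh 1 and
      -- 1 + 2 = 3, and that of radius 3 at most 8.
      set j := if π v = 0 then 1 else m - 1 with hj
      have hjm : j ≤ m := by rw [hj]; split_ifs <;> omega
      have hball : (Finset.univ.filter fun w => G.dist v w ≤ 1) =
          insert v (Finset.univ.filter fun w => π w = j) := by
        ext w
        have := h.le w
        simp only [Finset.mem_filter, Finset.mem_univ, true_and, hd, Nat.dist, Finset.mem_insert]
        rw [hj]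
        split_ifs with h1 h2 h3 h3
        all_goals first | (subst h1; simp) | skip
        all_goals
          simp only [show ¬ w = v from fun h => h1 h.symm, false_or]
          omega
      have hb1 : ∑ w with G.dist v w ≤ 1, μ w = 3 := by
        rw [hball, Finset.sum_insert, h.sum_fibre hjm, hμv]
        · norm_num
        · simp only [Finset.mem_filter, Finset.mem_univ, true_and, hj]
          split_ifs <;> omega
      have hb0 : ∑ w with G.dist v w ≤ 0, μ w = 1 := by
        rw [← hμv]
        convert Finset.sum_singleton μ v
        ext w
        simp only [Finset.mem_filter, Finset.mem_univ, true_and, hd, Nat.dist,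
          Finset.mem_singleton]
        split_ifs with h1 h2
        · simp [h1]
        · simpa using fun h => h1 h.symm
        · simp only [show ¬ w = v from fun h => h1 h.symm, iff_false]
          omega
      obtain rfl | rfl : k = 0 ∨ k = 1 := by omega
      · rw [hb0, mul_zero, zero_add, hb1]
        norm_num
      · rw [hb1]
        refine (hle _).trans ?_
        have : 2 * (min m (π v + (2 * 1 + 1)) + 1 - (π v - (2 * 1 + 1))) ≤ 3 * 3 := by omega
        exact_mod_cast this

end Fibred

lemma isFibredPath_pathGraph (n : ℕ) :
    IsFibredPath (SimpleGraph.pathGraph (n + 1)) (fun i => i.val) n fun _ => 2 where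
  adj_iff u v := by rw [SimpleGraph.pathGraph_adj]
  le v := by omega
  fibre j hj := .inl ⟨⟨j, by omega⟩, rfl, fun w => by simp [Fin.ext_iff]⟩

lemma isFibredPath_dynkinD {n : ℕ} (hn : 4 ≤ n) :
    IsFibredPath (dynkinD n) (fun i => if i.val + 1 < n then i.val else n - 2) (n - 2)
      fun i => if i.val + 2 < n then 2 else 1 where
  adj_iff u v := by
    simp only [dynkinD, SimpleGraph.fromRel_adj, ne_eq, Fin.ext_iff]
    split_ifs <;> omega
  le v := by split_ifs <;> omega
  fibre j hj := by
    rcases eq_or_ne j (n - 2) with h | h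
    · refine .inr ⟨⟨n - 2, by omega⟩, ⟨n - 1, by omega⟩, ?_, ?_, ?_, by omega, .inr h, fun w => ?_⟩
      · simp
        omega
      · rw [if_neg (by simp; omega)]
      · rw [if_neg (by simp; omega)]
      · simp only [Fin.ext_iff]
        split_ifs <;> omega
    · refine .inl ⟨⟨j, by omega⟩, ?_, fun w => ?_⟩
      · rw [if_pos (by simp; omega)]
      · simp only [Fin.ext_iff]
        split_ifs <;> omega

lemma isFibredPath_extDynkinD {n : ℕ} (hn : 5 ≤ n) :
    IsFibredPath (extDynkinD n)
      (fun i => if i.val + 2 < n then i.val else if i.val + 1 < n then 0 else n - 3) (n - 3)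
      fun i => if 0 < i.val ∧ i.val + 3 < n then 2 else 1 where
  adj_iff u v := by
    simp only [extDynkinD, SimpleGraph.fromRel_adj, ne_eq, Fin.ext_iff]
    split_ifs <;> first | omega | (simp only [false_or, or_false, iff_false]; omega)
  le v := by split_ifs <;> omega
  fibre j hj := by
    by_cases h : j = 0 ∨ j = n - 3
    · refine .inr ⟨⟨j, by omega⟩, ⟨if j = 0 then n - 2 else n - 1, by split_ifs <;> omega⟩,
        ?_, ?_, ?_, by omega, h, fun w => ?_⟩
      · simp only [ne_eq, Fin.ext_iff]
        split_ifs <;> omega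
      · rw [if_neg (by rintro ⟨h1, h2⟩; simp only at h1 h2; omega)]
      · rw [if_neg (by simp only; split_ifs <;> omega)]
      · simp only [Fin.ext_iff]
        split_ifs <;> omega
    · refine .inl ⟨⟨j, by omega⟩, ?_, fun w => ?_⟩
      · rw [if_pos (by simp; omega)]
      · simp only [Fin.ext_iff]
        split_ifs <;> omega

/-! ### Counting measure on cycles -/

section Cycle

open SimpleGraph

lemma cycleGraph_exists_zsmul {n : ℕ} {v w : Fin (n + 2)} (p : (cycleGraph (n + 2)).Walk v w) :
    ∃ i : ℤ, |i| ≤ p.length ∧ w = v + i • (1 : Fin (n + 2)) := by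
  induction p with
  | nil => exact ⟨0, by simp⟩
  | cons h p ih =>
    obtain ⟨i, hi, rfl⟩ := ih
    rw [cycleGraph_adj] at h
    rw [Walk.length_cons]
    push_cast
    rcases h with h | h
    · refine ⟨i - 1, by rw [abs_le] at hi ⊢; omega, ?_⟩
      rw [sub_smul, one_smul, ← h]
      abel
    · refine ⟨i + 1, by rw [abs_le] at hi ⊢; omega, ?_⟩
      rw [add_smul, one_smul, ← h]
      abel

lemma cycleGraph_dist_add_nsmul_le {n : ℕ} (v : Fin (n + 2)) (j : ℕ) :
    (cycleGraph (n + 2)).dist v (v + j • (1 : Fin (n + 2))) ≤ j := by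
  induction j with
  | zero => simp
  | succ j ih =>
    refine (cycleGraph_connected.dist_triangle (v := v + j • (1 : Fin (n + 2)))).trans ?_
    refine add_le_add ih ?_
    rw [succ_nsmul, ← add_assoc]
    exact (dist_eq_one_iff_adj.2 (by simp [cycleGraph_adj])).le

lemma cycleGraph_dist_le_iff {n : ℕ} (v w : Fin (n + 2)) (k : ℕ) :
    (cycleGraph (n + 2)).dist v w ≤ k ↔ ∃ i : ℤ, |i| ≤ k ∧ w = v + i • (1 : Fin (n + 2)) := by
  constructor
  · intro h
    obtain ⟨p, hp⟩ := cycleGraph_connected.exists_walk_length_eq_dist v w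
    obtain ⟨i, hi, hw⟩ := cycleGraph_exists_zsmul p
    exact ⟨i, hi.trans (by rw [hp]; exact_mod_cast h), hw⟩
  · rintro ⟨i, hi, rfl⟩
    obtain ⟨j, rfl | rfl⟩ := i.eq_nat_or_neg
    · rw [natCast_zsmul]
      refine (cycleGraph_dist_add_nsmul_le v j).trans ?_
      simpa using hi
    · rw [dist_comm, neg_smul, natCast_zsmul]
      have := cycleGraph_dist_add_nsmul_le (v + -(j • (1 : Fin (n + 2)))) j
      rw [neg_add_cancel_right] at this
      refine this.trans ?_
      simpa using hi

/-- The ball of radius `2k + 1` is covered by the ball of radius `k` and its two rotations by `±(2k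
+ 1)`. -/
lemma isTripling_cycleGraph (n : ℕ) : IsTripling (cycleGraph (n + 2)) fun _ => 1 := by
  refine ⟨fun _ => one_pos, fun v k => ?_⟩
  set B := Finset.univ.filter fun w => (cycleGraph (n + 2)).dist v w ≤ k with hB
  set s : Fin (n + 2) := (2 * k + 1 : ℤ) • 1 with hs
  have hsub : (Finset.univ.filter fun w => (cycleGraph (n + 2)).dist v w ≤ 2 * k + 1) ⊆
      B ∪ (B.image (· + s) ∪ B.image (· - s)) := by
    intro w
    simp only [Finset.mem_filter, Finset.mem_univ, true_and, Finset.mem_union, Finset.mem_image,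
      hB, cycleGraph_dist_le_iff]
    rintro ⟨i, hi, rfl⟩
    rw [abs_le] at hi
    push_cast at hi
    by_cases h1 : |i| ≤ k
    · exact .inl ⟨i, h1, rfl⟩
    · rw [abs_le] at h1
      rcases le_total i 0 with h0 | h0
      · refine .inr (.inr ⟨_, ⟨i + (2 * k + 1), by rw [abs_le]; omega, rfl⟩, ?_⟩)
        rw [hs, add_smul]
        abel
      · refine .inr (.inl ⟨_, ⟨i - (2 * k + 1), by rw [abs_le]; omega, rfl⟩, ?_⟩)
        rw [hs, sub_smul]
        abel
  have hcard := (Finset.card_le_card hsub).trans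
    ((Finset.card_union_le _ _).trans (Nat.add_le_add_left (Finset.card_union_le _ _) _))
  have h1 := Finset.card_image_le (s := B) (f := (· + s))
  have h2 := Finset.card_image_le (s := B) (f := (· - s))
  simp only [Finset.sum_const, nsmul_eq_mul, mul_one]
  exact_mod_cast (show _ ≤ 3 * B.card by omega)

end Cycle

/-! ### Smith's rigidity argument and copies in trees -/

section Rigidity

variable {V W : Type*} {G : SimpleGraph V} {H : SimpleGraph W} {f : W → V}

lemma nonempty_iso_of_closed [Nonempty W] (hG : G.Connected) (hinj : Function.Injective f)
    (hom : ∀ a b, H.Adj a b → G.Adj (f a) (f b))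
    (hcl : ∀ a w, G.Adj (f a) w → ∃ b, H.Adj a b ∧ f b = w) : Nonempty (G ≃g H) := by
  have hwalk : ∀ {u v : V} (_ : G.Walk u v), u ∈ Set.range f → v ∈ Set.range f := by
    intro u v p
    induction p with
    | nil => exact id
    | cons h _ ih =>
      rintro ⟨a, rfl⟩
      obtain ⟨b, _, hb⟩ := hcl a _ h
      exact ih ⟨b, hb⟩
  have hsurj : Function.Surjective f := fun v =>
    hwalk (hG.preconnected (f (Classical.arbitrary W)) v).some ⟨_, rfl⟩
  refine ⟨SimpleGraph.Iso.symm
    ⟨Equiv.ofBijective f ⟨hinj, hsurj⟩, fun {a b} => ⟨fun h => ?_, hom a b⟩⟩⟩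
  obtain ⟨c, hc, hcb⟩ := hcl a _ h
  rwa [← hinj hcb]

/-- Smith's argument: a graph with a positive weight `μ` satisfying `A μ ≤ 2 μ` contains no proper
copy of a graph with a positive weight `δ` satisfying `2 δ ≤ A δ`. -/
theorem nonempty_iso_of_subharmonic [Fintype V] [Fintype W] [Nonempty W] (hG : G.Connected)
    {μ : V → ℝ} (hμ : IsTripling G μ) (hinj : Function.Injective f)
    (hom : ∀ a b, H.Adj a b → G.Adj (f a) (f b)) {δ : W → ℝ} (hδ : ∀ a, 0 < δ a)
    (s : W → Finset W) (hs : ∀ a, ∀ b ∈ s a, H.Adj a b) (hsum : ∀ a, 2 * δ a ≤ ∑ b ∈ s a, δ b) :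
    Nonempty (G ≃g H) := by
  classical
  have hsum' : ∀ a, 2 * δ a ≤ ∑ b with H.Adj a b, δ b := fun a =>
    (hsum a).trans <| Finset.sum_le_sum_of_subset_of_nonneg (fun b hb => by simpa using hs a b hb)
      fun b _ _ => (hδ b).le
  have himage : ∀ a, ∑ b with H.Adj a b, μ (f b) =
      ∑ w ∈ (Finset.univ.filter fun b => H.Adj a b).image f, μ w := fun a =>
    (Finset.sum_image fun _ _ _ _ h => hinj h).symm
  have hsub : ∀ a, (Finset.univ.filter fun b => H.Adj a b).image f ⊆
      Finset.univ.filter fun w => G.Adj (f a) w := by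
    intro a w
    simp only [Finset.mem_image, Finset.mem_filter, Finset.mem_univ, true_and]
    rintro ⟨b, hb, rfl⟩
    exact hom a b hb
  have hle : ∀ a, ∑ b with H.Adj a b, μ (f b) ≤ ∑ w with G.Adj (f a) w, μ w := fun a => by
    rw [himage]
    exact Finset.sum_le_sum_of_subset_of_nonneg (hsub a) fun w _ _ => (hμ.1 w).le
  have hdefect : ∀ a, ∑ b with H.Adj a b, μ (f b) ≤ 2 * μ (f a) := fun a =>
    (hle a).trans (isTripling_neighbor_sum hG hμ.2 _)
  -- Symmetry of the adjacency operator moves it from `μ` to `δ`. Together with `hdefect`, this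
  -- forces equality at every vertex.
  have htotal : ∑ a, δ a * (2 * μ (f a)) ≤ ∑ a, δ a * ∑ b with H.Adj a b, μ (f b) := by
    have hswap : ∑ a, δ a * ∑ b with H.Adj a b, μ (f b) =
        ∑ b, μ (f b) * ∑ a with H.Adj b a, δ a := by
      simp only [Finset.mul_sum, Finset.sum_filter]
      rw [Finset.sum_comm]
      refine Finset.sum_congr rfl fun b _ => Finset.sum_congr rfl fun a _ => ?_
      simp only [H.adj_comm a b]
      split_ifs <;> ring
    rw [hswap]
    refine Finset.sum_le_sum fun b _ => ?_
    have := mul_le_mul_of_nonneg_left (hsum' b) (hμ.1 (f b)).le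
    linarith
  have heq : ∀ a, δ a * ∑ b with H.Adj a b, μ (f b) = δ a * (2 * μ (f a)) := by
    have h1 : ∀ a ∈ Finset.univ, δ a * ∑ b with H.Adj a b, μ (f b) ≤ δ a * (2 * μ (f a)) :=
      fun a _ => mul_le_mul_of_nonneg_left (hdefect a) (hδ a).le
    exact fun a => (Finset.sum_eq_sum_iff_of_le h1).1
      (le_antisymm (Finset.sum_le_sum h1) htotal) a (Finset.mem_univ a)
  refine nonempty_iso_of_closed hG hinj hom fun a w haw => ?_
  -- A neighbour of `f a` not coming from `H` would add positive weight and make `hdefect` strict at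
  -- `a`.
  by_contra! hw
  have hlt : ∑ b with H.Adj a b, μ (f b) < ∑ w with G.Adj (f a) w, μ w := by
    rw [himage]
    refine Finset.sum_lt_sum_of_subset (hsub a) (i := w) (by simpa using haw) ?_ (hμ.1 w)
      fun v _ _ => (hμ.1 v).le
    simp only [Finset.mem_image, Finset.mem_filter, Finset.mem_univ, true_and, not_exists, not_and]
    exact hw
  have h2 := isTripling_neighbor_sum hG hμ.2 (f a)
  have h3 := mul_left_cancel₀ (hδ a).ne' (heq a)
  linarith

/-- Every edge of a forest is a bridge, but an edge outside the copy of the connected graph `H`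
would have its ends still joined inside the copy. -/
lemma adj_of_isAcyclic (hG : G.IsAcyclic) (hH : H.Connected) (hinj : Function.Injective f)
    (hom : ∀ a b, H.Adj a b → G.Adj (f a) (f b)) {a b : W} (h : G.Adj (f a) (f b)) :
    H.Adj a b := by
  by_contra hab
  have hbr := SimpleGraph.isAcyclic_iff_forall_adj_isBridge.1 hG h
  rw [SimpleGraph.isBridge_iff] at hbr
  let φ : H →g G.deleteEdges {s(f a, f b)} := ⟨f, fun {c d} hcd => by
    rw [SimpleGraph.deleteEdges_adj]
    refine ⟨hom c d hcd, fun he => hab ?_⟩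
    rw [Set.mem_singleton_iff, Sym2.eq_iff] at he
    rcases he with ⟨h1, h2⟩ | ⟨h1, h2⟩
    · rwa [← hinj h1, ← hinj h2]
    · rw [← hinj h1, ← hinj h2]
      exact hcd.symm⟩
  exact hbr ((hH.preconnected a b).map φ)

lemma nonempty_iso_or_exists_adj (hG : G.Connected) (hac : G.IsAcyclic) (hH : H.Connected)
    (hinj : Function.Injective f) (hom : ∀ a b, H.Adj a b → G.Adj (f a) (f b)) :
    Nonempty (G ≃g H) ∨ ∃ a x, G.Adj (f a) x ∧ x ∉ Set.range f := by
  by_contra! hcon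
  have := hH.nonempty
  refine not_nonempty_iff.2 hcon.1 (nonempty_iso_of_closed hG hinj hom fun a w haw => ?_)
  obtain ⟨b, rfl⟩ := hcon.2 a w haw
  exact ⟨b, adj_of_isAcyclic hac hH hinj hom haw, rfl⟩

lemma adj_of_fromRel_adj {r : W → W → Prop} (h : ∀ a b, r a b → G.Adj (f a) (f b)) (a b : W)
    (hab : (SimpleGraph.fromRel r).Adj a b) : G.Adj (f a) (f b) := by
  rcases (SimpleGraph.fromRel_adj _ _ _).1 hab with ⟨_, h1 | h1⟩
  exacts [h _ _ h1, (h _ _ h1).symm]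

end Rigidity

/-! ### Forbidden proper copies -/

section Copies

variable {V : Type*} [Fintype V] {G : SimpleGraph V} {μ : V → ℝ}

lemma nonempty_iso_cycleGraph (hG : G.Connected) (hμ : IsTripling G μ) {n : ℕ} (hn : 3 ≤ n)
    (h : (SimpleGraph.cycleGraph n).IsContained G) :
    Nonempty (G ≃g SimpleGraph.cycleGraph n) := by
  obtain ⟨f⟩ := h
  obtain ⟨n, rfl⟩ := Nat.exists_eq_add_of_le' hn
  refine nonempty_iso_of_subharmonic hG hμ f.injective (fun a b hab => f.toHom.map_adj hab)
    (δ := fun _ => 1) (fun _ => one_pos)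
    (fun a => (SimpleGraph.cycleGraph (n + 3)).neighborFinset a)
    (by simp) fun a => ?_
  rw [Finset.sum_const, SimpleGraph.card_neighborFinset_eq_degree,
    SimpleGraph.cycleGraph_degree_three_le]
  norm_num

lemma nonempty_iso_extDynkinD (hG : G.Connected) (hμ : IsTripling G μ) {n : ℕ} (hn : 5 ≤ n)
    {f : Fin n → V} (hinj : Function.Injective f)
    (hom : ∀ a b, (extDynkinD n).Adj a b → G.Adj (f a) (f b)) :
    Nonempty (G ≃g extDynkinD n) := by
  have : NeZero n := ⟨by omega⟩
  have h := isFibredPath_extDynkinD hn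
  set π : Fin n → ℕ := fun i => if i.val + 2 < n then i.val else if i.val + 1 < n then 0 else n - 3
  -- The fibred weight itself serves as `δ`: interior vertices have weight 2 and two neighbouring
  -- fibres of weight 2, end vertices have weight 1 and one such fibre.
  refine nonempty_iso_of_subharmonic hG hμ hinj hom h.pos
    (fun a => (Finset.univ.filter fun b => π b + 1 = π a) ∪
      Finset.univ.filter fun b => π a + 1 = π b) ?_ fun a => ?_
  · intro a b
    rw [h.adj_iff]
    simp only [Finset.mem_union, Finset.mem_filter, Finset.mem_univ, true_and]
    exact Or.symm
  · have hdisj : Disjoint (Finset.univ.filter fun b => π b + 1 = π a)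
        (Finset.univ.filter fun b => π a + 1 = π b) := by
      rw [Finset.disjoint_filter]
      omega
    rw [Finset.sum_union hdisj]
    have hup : π a + 1 ≤ n - 3 → ∑ b with π a + 1 = π b,
        (if 0 < b.val ∧ b.val + 3 < n then (2 : ℝ) else 1) = 2 := by
      intro ha
      refine Eq.trans ?_ (h.sum_fibre ha)
      simp only [eq_comm]
    have hdown : 1 ≤ π a → ∑ b with π b + 1 = π a,
        (if 0 < b.val ∧ b.val + 3 < n then (2 : ℝ) else 1) = 2 := by
      intro ha
      refine Eq.trans ?_ (h.sum_fibre (j := π a - 1) (by have := h.le a; omega))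
      congr 1
      ext b
      simp only [Finset.mem_filter, Finset.mem_univ, true_and]
      omega
    have hnn : ∀ s : Finset (Fin n),
        0 ≤ ∑ b ∈ s, (if 0 < b.val ∧ b.val + 3 < n then (2 : ℝ) else 1) := fun s =>
      Finset.sum_nonneg fun b _ => (h.pos b).le
    have hπ : π a = if a.val + 2 < n then a.val else if a.val + 1 < n then 0 else n - 3 := rfl
    by_cases ha : 0 < a.val ∧ a.val + 3 < n
    · rw [if_pos ha, hup, hdown]
      · norm_num
      all_goals
        rw [hπ, if_pos (by omega)]
        omega
    · rw [if_neg ha]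
      by_cases h0 : 1 ≤ π a
      · rw [hdown h0]
        linarith [hnn (Finset.univ.filter fun b => π a + 1 = π b)]
      · rw [hup (by omega)]
        linarith [hnn (Finset.univ.filter fun b => π b + 1 = π a)]

lemma not_contains_of_comb (hG : G.Connected) (hμ : IsTripling G μ) {n : ℕ} [NeZero n]
    {H : SimpleGraph (Fin n)} (hnot : ∀ ν, ¬ IsTripling H ν) {p c : ℕ}
    (hd : H.Connected ∧ ∀ u v, H.dist u v = combDist p c u v) {f : Fin n → V}
    (hinj : Function.Injective f) (hom : ∀ a b, H.Adj a b → G.Adj (f a) (f b)) (δ : Fin n → ℕ)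
    (hδ : ∀ a, 0 < δ a)
    (hsum : ∀ a, 2 * δ a ≤ ∑ b ∈ Finset.univ.filter fun b : Fin n => combDist p c a b = 1, δ b) :
    False := by
  obtain ⟨e⟩ := nonempty_iso_of_subharmonic hG hμ hinj hom (δ := fun a => (δ a : ℝ))
    (fun a => Nat.cast_pos.2 (hδ a))
    (fun a => Finset.univ.filter fun b : Fin n => combDist p c a b = 1)
    (fun a b hb => by
      rw [← SimpleGraph.dist_eq_one_iff_adj, hd.2]
      simpa using hb) (fun a => by exact_mod_cast hsum a)
  exact hnot _ (hμ.of_iso e.symm hd.1)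

lemma not_contains_extDynkinE6 (hG : G.Connected) (hμ : IsTripling G μ) {f : Fin 7 → V}
    (hinj : Function.Injective f) (hom : ∀ a b, extDynkinE6.Adj a b → G.Adj (f a) (f b)) : False :=
  not_contains_of_comb hG hμ not_isTripling_extDynkinE6 dist_extDynkinE6 hinj hom
    (fun a => [1, 2, 3, 2, 1, 2, 1].getD a 0) (by decide +kernel) (by decide +kernel)

lemma not_contains_extDynkinE7 (hG : G.Connected) (hμ : IsTripling G μ) {f : Fin 8 → V}
    (hinj : Function.Injective f) (hom : ∀ a b, extDynkinE7.Adj a b → G.Adj (f a) (f b)) : False :=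
  not_contains_of_comb hG hμ not_isTripling_extDynkinE7 dist_extDynkinE7 hinj hom
    (fun a => [1, 2, 3, 4, 3, 2, 1, 2].getD a 0) (by decide +kernel) (by decide +kernel)

lemma not_contains_extDynkinE8 (hG : G.Connected) (hμ : IsTripling G μ) {f : Fin 9 → V}
    (hinj : Function.Injective f) (hom : ∀ a b, extDynkinE8.Adj a b → G.Adj (f a) (f b)) : False :=
  not_contains_of_comb hG hμ not_isTripling_extDynkinE8 dist_extDynkinE8 hinj hom
    (fun a => [2, 4, 6, 5, 4, 3, 2, 1, 3].getD a 0) (by decide +kernel) (by decide +kernel)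

end Copies

/-! ### Longest paths and paths with pendant vertices -/

section Paths

variable {V : Type*} {G : SimpleGraph V}

/-- `p 0, …, p m` are the successive vertices of a path in `G`. -/
structure IsPathSeq (G : SimpleGraph V) (p : ℕ → V) (m : ℕ) : Prop where
  inj : ∀ i j, i ≤ m → j ≤ m → p i = p j → i = j
  adj : ∀ i < m, G.Adj (p i) (p (i + 1))

variable {p : ℕ → V} {m : ℕ}

lemma IsPathSeq.reverse (h : IsPathSeq G p m) : IsPathSeq G (fun i => p (m - i)) m where
  inj i j hi hj hij := by
    have := h.inj _ _ (by omega) (by omega) hij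
    omega
  adj i hi := by
    have := h.adj (m - (i + 1)) (by omega)
    rw [show m - (i + 1) + 1 = m - i by omega] at this
    exact this.symm

lemma IsPathSeq.cons (h : IsPathSeq G p m) {x : V} (hx : ∀ i ≤ m, p i ≠ x)
    (hadj : G.Adj (p 0) x) : ∃ q, IsPathSeq G q (m + 1) := by
  refine ⟨fun i => if i = 0 then x else p (i - 1), fun i j hi hj hij => ?_, fun i hi => ?_⟩
  · split_ifs at hij with h1 h2 h2
    · omega
    · exact absurd hij.symm (hx _ (by omega))
    · exact absurd hij (hx _ (by omega))
    · have := h.inj _ _ (by omega) (by omega) hij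
      omega
  · rcases Nat.eq_zero_or_pos i with rfl | h0
    · simpa using hadj.symm
    · have := h.adj (i - 1) (by omega)
      rw [show i - 1 + 1 = i by omega] at this
      simpa [h0.ne'] using this

lemma IsPathSeq.concat (h : IsPathSeq G p m) {x : V} (hx : ∀ i ≤ m, p i ≠ x)
    (hadj : G.Adj (p m) x) : ∃ q, IsPathSeq G q (m + 1) :=
  h.reverse.cons (fun i _ => hx _ (by omega)) hadj

lemma exists_maximal_isPathSeq [Finite V] [Nonempty V] (G : SimpleGraph V) :
    ∃ m p, IsPathSeq G p m ∧ ¬ ∃ q, IsPathSeq G q (m + 1) := by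
  classical
  have := Fintype.ofFinite V
  by_contra! hcon
  have hall : ∀ m, ∃ p, IsPathSeq G p m := by
    intro m
    induction m with
    | zero => exact ⟨fun _ => Classical.arbitrary V, ⟨fun i j hi hj _ => by omega, by simp⟩⟩
    | succ m ih =>
      obtain ⟨p, hp⟩ := ih
      exact hcon m p hp
  obtain ⟨p, hp⟩ := hall (Fintype.card V)
  have := Fintype.card_le_of_injective (fun i : Fin (Fintype.card V + 1) => p i) fun i j hij =>
    Fin.ext (hp.inj _ _ (by omega) (by omega) hij)
  simp at this

/-- The vertices `p a, …, p (a + M)`, followed by the vertices `w` and `x`. -/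
def pendant (p : ℕ → V) (a M : ℕ) (w x : V) (k : ℕ) : V :=
  if k ≤ M then p (a + k) else if k = M + 1 then w else x

variable {a M : ℕ} {w x : V}

lemma pendant_of_le {k : ℕ} (hk : k ≤ M) : pendant p a M w x k = p (a + k) := if_pos hk

lemma pendant_succ : pendant p a M w x (M + 1) = w := by simp [pendant]

lemma pendant_succ_succ : pendant p a M w x (M + 2) = x := by simp [pendant]

lemma IsPathSeq.pendant_injOn (h : IsPathSeq G p m) (ha : a + M ≤ m) (hw : ∀ i ≤ m, p i ≠ w)
    {k l : ℕ} (hk : k ≤ M + 1) (hl : l ≤ M + 1)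
    (hkl : pendant p a M w x k = pendant p a M w x l) : k = l := by
  unfold pendant at hkl
  split_ifs at hkl
  · have := h.inj _ _ (by omega) (by omega) hkl
    omega
  · exact absurd hkl (hw _ (by omega))
  · omega
  · exact absurd hkl.symm (hw _ (by omega))
  all_goals omega

lemma IsPathSeq.pendant_injOn_succ (h : IsPathSeq G p m) (ha : a + M ≤ m)
    (hw : ∀ i ≤ m, p i ≠ w) (hx : ∀ i ≤ m, p i ≠ x) (hwx : w ≠ x) {k l : ℕ} (hk : k ≤ M + 2)
    (hl : l ≤ M + 2) (hkl : pendant p a M w x k = pendant p a M w x l) : k = l := by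
  unfold pendant at hkl
  split_ifs at hkl
  · have := h.inj _ _ (by omega) (by omega) hkl
    omega
  · exact absurd hkl (hw _ (by omega))
  · exact absurd hkl (hx _ (by omega))
  · exact absurd hkl.symm (hw _ (by omega))
  · omega
  · exact absurd hkl hwx
  · exact absurd hkl.symm (hx _ (by omega))
  · exact absurd hkl.symm hwx
  · omega

lemma IsPathSeq.pendant_adj (h : IsPathSeq G p m) (ha : a + M ≤ m) {k l : ℕ} (hkl : k + 1 = l)
    (hl : l ≤ M) : G.Adj (pendant p a M w x k) (pendant p a M w x l) := by
  subst hkl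
  rw [pendant_of_le hl, pendant_of_le (by omega)]
  exact h.adj _ (by omega)

lemma pendant_adj_succ {c k l : ℕ} (hadj : G.Adj (p c) w) (hk : a + k = c) (hkM : k ≤ M)
    (hl : l = M + 1) : G.Adj (pendant p a M w x k) (pendant p a M w x l) := by
  subst hl hk
  rwa [pendant_of_le hkM, pendant_succ]

lemma pendant_adj_succ_succ {c k l : ℕ} (hadj : G.Adj (p c) x) (hk : a + k = c) (hkM : k ≤ M)
    (hl : l = M + 2) : G.Adj (pendant p a M w x k) (pendant p a M w x l) := by
  subst hl hk
  rwa [pendant_of_le hkM, pendant_succ_succ]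

lemma notMem_pendant {y : V} {n : ℕ} (hn : n = M + 2)
    (hy : y ∉ Set.range fun k : Fin n => pendant p a M w x k) :
    (∀ k ≤ M, p (a + k) ≠ y) ∧ w ≠ y := by
  subst hn
  refine ⟨fun k hk hky => hy ⟨⟨k, by omega⟩, ?_⟩, fun hwy => hy ⟨⟨M + 1, by omega⟩, ?_⟩⟩
  · simpa [pendant_of_le hk] using hky
  · simpa [pendant_succ] using hwy

end Paths

/-! ### Classification by branches off a longest path -/

section Classification

variable {V : Type*} {G : SimpleGraph V}

/-- The graphs of the classification. -/
def IsListed (G : SimpleGraph V) : Prop :=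
  Nonempty (G ≃g dynkinE6) ∨ Nonempty (G ≃g dynkinE7) ∨
    (∃ n : ℕ, 1 ≤ n ∧ Nonempty (G ≃g SimpleGraph.pathGraph n)) ∨
    (∃ n : ℕ, 4 ≤ n ∧ Nonempty (G ≃g dynkinD n)) ∨
    (∃ n : ℕ, 3 ≤ n ∧ Nonempty (G ≃g SimpleGraph.cycleGraph n)) ∨
    (∃ n : ℕ, 5 ≤ n ∧ Nonempty (G ≃g extDynkinD n))

variable [Fintype V] {μ : V → ℝ} {p : ℕ → V} {m : ℕ}

/-- The segment from `p (i - 1)` to `p (j + 1)` with `w` and `x` is a copy of an extended `D` graph,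
hence all of `G`; `i = j` gives the four-leaf star. -/
lemma IsPathSeq.isListed_of_two_branches (hG : G.Connected) (hμ : IsTripling G μ)
    (h : IsPathSeq G p m) {i j : ℕ} {w x : V} (hi : 0 < i) (hij : i ≤ j) (hj : j < m)
    (hw : ∀ k ≤ m, p k ≠ w) (hx : ∀ k ≤ m, p k ≠ x) (hwx : w ≠ x) (hiw : G.Adj (p i) w)
    (hjx : G.Adj (p j) x) : IsListed G := by
  obtain ⟨d, rfl⟩ := Nat.exists_eq_add_of_le hij
  refine .inr (.inr (.inr (.inr (.inr ⟨d + 5, by omega, ?_⟩))))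
  refine nonempty_iso_extDynkinD hG hμ (by omega)
    (f := fun k : Fin (d + 5) => pendant p (i - 1) (d + 2) w x k)
    (fun k l hkl => Fin.ext (h.pendant_injOn_succ (by omega) hw hx hwx (by omega) (by omega) hkl))
    (adj_of_fromRel_adj ?_)
  rintro k l (⟨h1, h2⟩ | ⟨h1, h2⟩ | ⟨h1, h2⟩)
  · exact h.pendant_adj (by omega) h1 (by omega)
  · exact pendant_adj_succ hiw (by omega) (by omega) (by omega)
  · exact pendant_adj_succ_succ hjx (by omega) (by omega) (by omega)

/-- A second vertex off the path contradicts maximality or yields an extended `D` graph. Otherwise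
the distance `i` from the branch to the nearer end decides: `D` for 1, the `E` series for 2, a
forbidden extended `E_7` from 3 on. -/
lemma IsPathSeq.isListed_of_branch (hG : G.Connected) (hμ : IsTripling G μ) (hac : G.IsAcyclic)
    (h : IsPathSeq G p m) (hmax : ¬ ∃ q, IsPathSeq G q (m + 1)) {i : ℕ} {w : V} (hi : 0 < i)
    (him : 2 * i ≤ m) (hw : ∀ k ≤ m, p k ≠ w) (hiw : G.Adj (p i) w) : IsListed G := by
  have hother : ∀ j ≤ m, ∀ x, (∀ k ≤ m, p k ≠ x) → w ≠ x → G.Adj (p j) x → IsListed G := by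
    intro j hj x hx hwx hjx
    rcases Nat.eq_zero_or_pos j with rfl | hj0
    · exact absurd (h.cons hx hjx) hmax
    rcases hj.eq_or_lt with rfl | hjm
    · exact absurd (h.concat hx hjx) hmax
    rcases le_total i j with hij | hij
    · exact h.isListed_of_two_branches hG hμ hi hij hjm hw hx hwx hiw hjx
    · exact h.isListed_of_two_branches hG hμ hj0 hij (by omega) hx hw hwx.symm hjx hiw
  obtain rfl | rfl | hi3 : i = 1 ∨ i = 2 ∨ 3 ≤ i := by omega
  -- The path is reversed because `dynkinD` has its branch near the last vertex. The second `w`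
  -- given to `pendant` below is a dummy, as `Fin (m + 2)` stops before that slot.
  · have hr := h.reverse
    have : NeZero (m + 2) := ⟨by omega⟩
    have hw' : ∀ k ≤ m, p (m - k) ≠ w := fun k _ => hw _ (by omega)
    have hiw' : G.Adj ((fun k => p (m - k)) (m - 1)) w := by
      simpa [show m - (m - 1) = 1 by omega] using hiw
    rcases nonempty_iso_or_exists_adj hG hac
      (isFibredPath_dynkinD (n := m + 2) (by omega)).dist_eq.1
      (f := fun k : Fin (m + 2) => pendant (fun k => p (m - k)) 0 m w w k)
      (fun k l hkl => Fin.ext (hr.pendant_injOn (by omega) hw' (by omega) (by omega) hkl))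
      (adj_of_fromRel_adj (by
        rintro k l (⟨h1, h2⟩ | ⟨h1, h2⟩)
        · exact hr.pendant_adj (by omega) h1 (by omega)
        · exact pendant_adj_succ hiw' (by omega) (by omega) (by omega))) with he | ⟨k, x, hkx, hx⟩
    · exact .inr (.inr (.inr (.inl ⟨m + 2, by omega, he⟩)))
    · obtain ⟨hx, hwx⟩ := notMem_pendant rfl hx
      have hx' : ∀ k ≤ m, p k ≠ x := fun k hk => by
        simpa [show m - (m - k) = k by omega] using hx (m - k) (by omega)
      rcases (show k.val ≤ m ∨ k.val = m + 1 by omega) with hk | hk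
      · rw [pendant_of_le hk] at hkx
        exact hother _ (by omega) x hx' hwx hkx
      · rw [hk, pendant_succ] at hkx
        -- Swapping the end `p 0` for `w` gives another longest path, so `w` has no new neighbour
        -- `x`.
        have hq : IsPathSeq G (fun k => if k = 0 then w else p k) m := by
          refine ⟨fun k l hk hl hkl => ?_, fun k hk => ?_⟩
          · split_ifs at hkl
            · omega
            · exact absurd hkl.symm (hw _ hl)
            · exact absurd hkl (hw _ hk)
            · exact h.inj _ _ hk hl hkl
          · rcases Nat.eq_zero_or_pos k with rfl | h0
            · simpa using hiw.symm
            · simpa [h0.ne'] using h.adj k hk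
        refine absurd (hq.cons (x := x) (fun k hk => ?_) (by simpa using hkx)) hmax
        split_ifs
        exacts [hwx, hx' k hk]
  -- A longer branch at `p 2` would give three arms of length 2, the extended `E_6`.
  · have hbranch : ∀ x, (∀ k ≤ m, p k ≠ x) → w ≠ x → ¬ G.Adj w x := by
      intro x hx hwx hadj
      refine not_contains_extDynkinE6 hG hμ (f := fun k : Fin 7 => pendant p 0 4 w x k)
        (fun k l hkl =>
          Fin.ext (h.pendant_injOn_succ (by omega) hw hx hwx (by omega) (by omega) hkl))
        (adj_of_fromRel_adj ?_)
      rintro k l (⟨h1, h2⟩ | ⟨h1, h2⟩ | ⟨h1, h2⟩)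
      · exact h.pendant_adj (by omega) h1 (by omega)
      · exact pendant_adj_succ hiw (by omega) (by omega) (by omega)
      · rw [h1, h2, pendant_succ (M := 4), pendant_succ_succ (M := 4)]
        exact hadj
    have hext : ∀ {H : SimpleGraph (Fin (m + 2))}, H.Connected →
        (∀ k l, H.Adj k l → G.Adj (pendant p 0 m w w k) (pendant p 0 m w w l)) →
        Nonempty (G ≃g H) ∨ IsListed G := by
      intro H hH hom
      refine (nonempty_iso_or_exists_adj hG hac hH (f := fun k : Fin (m + 2) => pendant p 0 m w w k)
        (fun k l hkl => Fin.ext (h.pendant_injOn (by omega) hw (by omega) (by omega) hkl))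
        hom).imp_right ?_
      rintro ⟨k, x, hkx, hx⟩
      obtain ⟨hx, hwx⟩ := notMem_pendant rfl hx
      simp only [zero_add] at hx
      rcases (show k.val ≤ m ∨ k.val = m + 1 by omega) with hk | hk
      · rw [pendant_of_le hk] at hkx
        exact hother _ (by omega) x hx hwx hkx
      · rw [hk, pendant_succ] at hkx
        exact absurd hkx (hbranch x hx hwx)
    -- These lengths give `E_6`, `E_7`, the excluded `E_8`, and a copy of the extended `E_8`.
    obtain rfl | rfl | rfl | hm7 : m = 4 ∨ m = 5 ∨ m = 6 ∨ 7 ≤ m := by omega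
    · rcases hext dist_dynkinE6.1 (adj_of_fromRel_adj (by
        rintro k l (⟨h1, h2⟩ | ⟨h1, h2⟩)
        · exact h.pendant_adj (by omega) h1 (by omega)
        · exact pendant_adj_succ hiw (by omega) (by omega) (by omega))) with he | he
      exacts [.inl he, he]
    · rcases hext dist_dynkinE7.1 (adj_of_fromRel_adj (by
        rintro k l (⟨h1, h2⟩ | ⟨h1, h2⟩)
        · exact h.pendant_adj (by omega) h1 (by omega)
        · exact pendant_adj_succ hiw (by omega) (by omega) (by omega))) with he | he
      exacts [.inr (.inl he), he]
    · rcases hext dist_dynkinE8.1 (adj_of_fromRel_adj (by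
        rintro k l (⟨h1, h2⟩ | ⟨h1, h2⟩)
        · exact h.pendant_adj (by omega) h1 (by omega)
        · exact pendant_adj_succ hiw (by omega) (by omega) (by omega))) with ⟨⟨e⟩⟩ | he
      exacts [absurd (hμ.of_iso e.symm dist_dynkinE8.1) (not_isTripling_dynkinE8 _), he]
    · refine (not_contains_extDynkinE8 hG hμ (f := fun k : Fin 9 => pendant p 0 7 w w k)
        (fun k l hkl => Fin.ext (h.pendant_injOn (by omega) hw (by omega) (by omega) hkl))
        (adj_of_fromRel_adj ?_)).elim
      rintro k l (⟨h1, h2⟩ | ⟨h1, h2⟩)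
      · exact h.pendant_adj (by omega) h1 (by omega)
      · exact pendant_adj_succ hiw (by omega) (by omega) (by omega)
  · refine (not_contains_extDynkinE7 hG hμ (f := fun k : Fin 8 => pendant p (i - 3) 6 w w k)
      (fun k l hkl => Fin.ext (h.pendant_injOn (by omega) hw (by omega) (by omega) hkl))
      (adj_of_fromRel_adj ?_)).elim
    rintro k l (⟨h1, h2⟩ | ⟨h1, h2⟩)
    · exact h.pendant_adj (by omega) h1 (by omega)
    · exact pendant_adj_succ hiw (by omega) (by omega) (by omega)

theorem IsTripling.isListed (hG : G.Connected) (hμ : IsTripling G μ) : IsListed G := by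
  by_cases hac : G.IsAcyclic
  · have := hG.nonempty
    obtain ⟨m, p, h, hmax⟩ := exists_maximal_isPathSeq G
    rcases nonempty_iso_or_exists_adj hG hac (SimpleGraph.pathGraph_connected m)
      (f := fun k : Fin (m + 1) => p k)
      (fun k l hkl => Fin.ext (h.inj _ _ (by omega) (by omega) hkl))
      (fun k l hkl => by
        rcases SimpleGraph.pathGraph_adj.1 hkl with h1 | h1
        · rw [← h1]
          exact h.adj _ (by omega)
        · rw [← h1]
          exact (h.adj _ (by omega)).symm) with he | ⟨⟨i, hi⟩, w, hiw, hw⟩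
    · exact .inr (.inr (.inl ⟨m + 1, by omega, he⟩))
    · have hw' : ∀ k ≤ m, p k ≠ w := fun k hk hkw => hw ⟨⟨k, by omega⟩, hkw⟩
      have hi0 : i ≠ 0 := by
        rintro rfl
        exact hmax (h.cons hw' hiw)
      have him : i ≠ m := by
        rintro rfl
        exact hmax (h.concat hw' hiw)
      -- Reversing the path if necessary puts the branch in its first half.
      rcases le_total (2 * i) m with h2 | h2
      · exact h.isListed_of_branch hG hμ hac hmax (by omega) h2 hw' hiw
      · exact h.reverse.isListed_of_branch hG hμ hac hmax (i := m - i) (by omega) (by omega)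
          (fun k _ => hw' _ (by omega)) (by simpa [show m - (m - i) = i by omega] using hiw)
  · simp only [SimpleGraph.IsAcyclic, not_forall, not_not] at hac
    obtain ⟨v, c, hc⟩ := hac
    have hlen := hc.three_le_length
    exact .inr (.inr (.inr (.inr (.inl ⟨c.length, hlen, nonempty_iso_cycleGraph hG hμ hlen
      ((SimpleGraph.cycleGraph_isContained_iff (by omega)).2 ⟨v, c, hc, rfl⟩)⟩))))

theorem IsListed.exists_isTripling (hG : G.Connected) (h : IsListed G) :
    ∃ μ, IsTripling G μ := by
  rcases h with ⟨⟨e⟩⟩ | ⟨⟨e⟩⟩ | ⟨n, hn, ⟨e⟩⟩ | ⟨n, hn, ⟨e⟩⟩ | ⟨n, hn, ⟨e⟩⟩ | ⟨n, hn, ⟨e⟩⟩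
  · obtain ⟨μ, hμ⟩ := exists_isTripling_dynkinE6
    exact ⟨_, hμ.of_iso e hG⟩
  · obtain ⟨μ, hμ⟩ := exists_isTripling_dynkinE7
    exact ⟨_, hμ.of_iso e hG⟩
  · obtain ⟨n, rfl⟩ := Nat.exists_eq_add_of_le' hn
    exact ⟨_, (isFibredPath_pathGraph n).isTripling.of_iso e hG⟩
  · have : NeZero n := ⟨by omega⟩
    exact ⟨_, (isFibredPath_dynkinD hn).isTripling.of_iso e hG⟩
  · obtain ⟨n, rfl⟩ := Nat.exists_eq_add_of_le' hn
    exact ⟨_, (isTripling_cycleGraph (n + 1)).of_iso e hG⟩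
  · have : NeZero n := ⟨by omega⟩
    exact ⟨_, (isFibredPath_extDynkinD hn).isTripling.of_iso e hG⟩

end Classification

lemma three_lt_leastDoublingConst {V : Type*} [Fintype V] {G : SimpleGraph V} (hG : G.Connected)
    (h : ∀ μ, ¬ IsTripling G μ) : 3 < leastDoublingConst G := by
  rw [← not_le, leastDoublingConst_le_iff hG, not_exists]
  exact h

end GraphDoubling

theorem corollary6p4 :
    (∀ (V : Type*) [Finite V] (G : SimpleGraph V), G.Connected →
      (GraphDoubling.leastDoublingConst G ≤ 3 ↔
        Nonempty (G ≃g GraphDoubling.dynkinE6) ∨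
        Nonempty (G ≃g GraphDoubling.dynkinE7) ∨
        (∃ n : ℕ, 1 ≤ n ∧ Nonempty (G ≃g SimpleGraph.pathGraph n)) ∨
        (∃ n : ℕ, 4 ≤ n ∧ Nonempty (G ≃g GraphDoubling.dynkinD n)) ∨
        (∃ n : ℕ, 3 ≤ n ∧ Nonempty (G ≃g SimpleGraph.cycleGraph n)) ∨
        (∃ n : ℕ, 5 ≤ n ∧ Nonempty (G ≃g GraphDoubling.extDynkinD n)))) ∧
    3 < GraphDoubling.leastDoublingConst GraphDoubling.dynkinE8 ∧
    3 < GraphDoubling.leastDoublingConst GraphDoubling.extDynkinE6 ∧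
    3 < GraphDoubling.leastDoublingConst GraphDoubling.extDynkinE7 ∧
    3 < GraphDoubling.leastDoublingConst GraphDoubling.extDynkinE8 := by
  refine ⟨fun V _ G hG => ?_, ?_, ?_, ?_, ?_⟩
  · have := Fintype.ofFinite V
    rw [GraphDoubling.leastDoublingConst_le_iff hG]
    exact ⟨fun ⟨_, hμ⟩ => hμ.isListed hG,
      fun h => GraphDoubling.IsListed.exists_isTripling hG h⟩
  · exact GraphDoubling.three_lt_leastDoublingConst GraphDoubling.dist_dynkinE8.1
      GraphDoubling.not_isTripling_dynkinE8
  · exact GraphDoubling.three_lt_leastDoublingConst GraphDoubling.dist_extDynkinE6.1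
      GraphDoubling.not_isTripling_extDynkinE6
  · exact GraphDoubling.three_lt_leastDoublingConst GraphDoubling.dist_extDynkinE7.1
      GraphDoubling.not_isTripling_extDynkinE7
  · exact GraphDoubling.three_lt_leastDoublingConst GraphDoubling.dist_extDynkinE8.1
      GraphDoubling.not_isTripling_extDynkinE8
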